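/- Let $1\le p<\infty$, let $L^p([0,1])$ be the complex $L^p$ space of the Lebesgue measure $\lambda$ on $[0,1]$, and let $T$ be a bounded linear operator on $L^p([0,1])$ that is narrow: for every Lebesgue measurable set $A\subset[0,1]$ with $\lambda(A)>0$ and every $\varepsilon>0$ there is a Lebesgue measurable function $g:[0,1]\to\{-1,0,1\}$ with $g^2=\mathbb{I}_A$ (the indicator function of $A$), $\int_0^1 g\,d\lambda=0$ and $\|Tg\|_{L^p}<\varepsilon$. Let $I$ be the identity operator and let $\mathbf{E}f:=\left(\int_0^1 f\,d\lambda\right)\mathbf{1}$, where $\mathbf 1$ is the constant function $1$. Then, for every $\gamma\in\mathbb{C}$, $$\|I-T\|_{L^p\to L^p}+\inf_{\|u\|_{L^p}=1}\|(\gamma I-T)u\|_{L^p}\ \ge\ \|I-\gamma\mathbf{E}\|_{L^p\to L^p}.$$ In particular, $$\|I-T\|_{L^p\to L^p}+\inf_{\|u\|_{L^p}=1}\|(I-T)u\|_{L^p}\ \ge\ C_p,$$ where $C_1:=2$ and, for $1<p<\infty$, $$C_p:=\max_{0\le\alpha\le1}\left(\alpha^{p-1}+(1-\alpha)^{p-1}\right)^{\frac1p}\left(\alpha^{\frac1{p-1}}+(1-\alpha)^{\frac1{p-1}}\right)^{1-\frac1p}.$$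 -/

import Mathlib

open MeasureTheory
open scoped ENNReal

noncomputable section

namespace NarrowOp

section Narrow

variable {Ω : Type*} [MeasurableSpace Ω]

/-- `g` is a sign on `A`: a measurable function with values in `{-1, 0, 1}` and `g ^ 2 = 𝟙_A`.
Measurability is with respect to the `μ`-completion of the `σ`-algebra (for the Lebesgue measure:
Lebesgue measurability). -/
structure IsSignOn (μ : Measure Ω) (A : Set Ω) (g : Ω → ℝ) : Prop where
  aemeasurable : AEMeasurable g μ
  mem_values : ∀ ω, g ω ∈ ({-1, 0, 1} : Set ℝ)
  sq_eq : ∀ ω, g ω ^ 2 = A.indicator (fun _ => (1 : ℝ)) ω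

/-- A sign on `A` with integral zero. -/
structure IsMeanZeroSignOn (μ : Measure Ω) (A : Set Ω) (g : Ω → ℝ) : Prop
    extends IsSignOn μ A g where
  integral_eq_zero : ∫ ω, g ω ∂μ = 0

/-- On a finite measure space a sign, seen as a complex function, belongs to `L^p`. -/
theorem IsSignOn.memLp {μ : Measure Ω} [IsFiniteMeasure μ] {A : Set Ω} {g : Ω → ℝ}
    (hg : IsSignOn μ A g) (p : ℝ≥0∞) : MemLp (fun ω => (g ω : ℂ)) p μ := by
  refine MemLp.of_bound
    (Complex.measurable_ofReal.comp_aemeasurable hg.aemeasurable).aestronglyMeasurable 1 ?_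
  refine Filter.Eventually.of_forall fun ω => ?_
  have h := hg.mem_values ω
  simp only [Set.mem_insert_iff, Set.mem_singleton_iff] at h
  rcases h with h | h | h <;> simp [h]

/-- A bounded operator `T : L^p(μ) → Y` is narrow if for every measurable set `A` of positive
measure and every `ε > 0` there is a mean zero sign `g` on `A` with `‖T g‖ < ε`.
Measurable sets are those of the completion of `μ` (for the Lebesgue measure: the Lebesgue
measurable sets). -/
def IsNarrow {μ : Measure Ω} [IsFiniteMeasure μ] {p : ℝ≥0∞} [Fact (1 ≤ p)]
    {Y : Type*} [NormedAddCommGroup Y] [NormedSpace ℂ Y] (T : Lp ℂ p μ →L[ℂ] Y) : Prop :=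
  ∀ A : Set Ω, NullMeasurableSet A μ → 0 < μ A → ∀ ε : ℝ, 0 < ε →
    ∃ (g : Ω → ℝ) (hg : IsMeanZeroSignOn μ A g),
      ‖T ((hg.toIsSignOn.memLp p).toLp (fun ω => (g ω : ℂ)))‖ < ε

end Narrow

section Mean

variable {Ω : Type*} [MeasurableSpace Ω] (μ : Measure Ω) [IsProbabilityMeasure μ]
  (p : ℝ≥0∞) [hp : Fact (1 ≤ p)]

/-- An `L^p` function on a probability space is integrable. -/
theorem integrable_of_Lp (f : Lp ℂ p μ) : Integrable f μ :=
  (Lp.memLp f).integrable hp.out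

/-- `|∫ f| ≤ ‖f‖_p` on a probability space. -/
theorem norm_integral_le (f : Lp ℂ p μ) : ‖∫ ω, f ω ∂μ‖ ≤ ‖f‖ := by
  refine (norm_integral_le_integral_norm _).trans ?_
  rw [integral_norm_eq_lintegral_enorm (Lp.aestronglyMeasurable f), Lp.norm_def,
    ← eLpNorm_one_eq_lintegral_enorm]
  exact ENNReal.toReal_mono (Lp.eLpNorm_ne_top f)
    (eLpNorm_le_eLpNorm_of_exponent_le hp.out (Lp.aestronglyMeasurable f))

/-- The integral as a bounded linear functional on `L^p` of a probability space. -/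
def integralLp : Lp ℂ p μ →L[ℂ] ℂ :=
  LinearMap.mkContinuous
    { toFun := fun f => ∫ ω, f ω ∂μ
      map_add' := fun f g => by
        rw [integral_congr_ae (Lp.coeFn_add f g)]
        exact integral_add (integrable_of_Lp μ p f) (integrable_of_Lp μ p g)
      map_smul' := fun c f => by
        rw [integral_congr_ae (Lp.coeFn_smul c f)]
        exact integral_smul c _ }
    1 (fun f => by simpa using norm_integral_le μ p f)

/-- The mean operator `E f = (∫ f dμ) 𝟏` on `L^p` of a probability space. -/
def meanOp : Lp ℂ p μ →L[ℂ] Lp ℂ p μ :=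
  (Lp.constL p μ ℂ).comp (integralLp μ p)

theorem meanOp_apply (f : Lp ℂ p μ) : meanOp μ p f = Lp.const p μ (∫ ω, f ω ∂μ) := rfl

end Mean

/-- The function of `α` whose maximum over `[0, 1]` is `C_p`, `1 < p < ∞`. -/
def cpFun (p α : ℝ) : ℝ :=
  (α ^ (p - 1) + (1 - α) ^ (p - 1)) ^ (1 / p) *
    (α ^ (1 / (p - 1)) + (1 - α) ^ (1 / (p - 1))) ^ (1 - 1 / p)

/-- `C_p`, the maximum of `cpFun p` over `[0, 1]` for `1 < p < ∞`, and `C_1 = 2`. -/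
def Cp (p : ℝ) : ℝ :=
  if p = 1 then 2 else sSup (cpFun p '' Set.Icc 0 1)

/-- The supremum in the definition of `C_p` is a maximum. -/
theorem isGreatest_Cp {p : ℝ} (hp : 1 < p) : IsGreatest (cpFun p '' Set.Icc 0 1) (Cp p) := by
  have h1 : 0 ≤ p - 1 := by linarith
  have h2 : 0 ≤ 1 / (p - 1) := by positivity
  have h3 : 0 ≤ 1 / p := by positivity
  have h4 : 0 ≤ 1 - 1 / p := by
    rw [sub_nonneg, div_le_one (by linarith)]
    exact hp.le
  have hc : Continuous (cpFun p) := by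
    have hs : Continuous fun α : ℝ => 1 - α := by fun_prop
    exact (((continuous_id.rpow_const fun _ => Or.inr h1).add
      (hs.rpow_const fun _ => Or.inr h1)).rpow_const fun _ => Or.inr h3).mul
      (((continuous_id.rpow_const fun _ => Or.inr h2).add
      (hs.rpow_const fun _ => Or.inr h2)).rpow_const fun _ => Or.inr h4)
  rw [Cp, if_neg hp.ne']
  exact (isCompact_Icc.image hc).isGreatest_sSup ((Set.nonempty_Icc.2 zero_le_one).image _)

end NarrowOp

end

namespace NarrowOp

/-! The core is the bilinear inequality `IsNarrow.norm_sub_meanOp_mul_le`. For step functions `u = ∑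
c i 𝟙_{A i}` and `f` with values `a k` on `2 ^ n` sets of equal measure, narrowness splits every `A
i` into `2 ^ n` equal pieces `S i k` with `T 𝟙_{S i k} ≈ 2 ^ (-n) T 𝟙_{A i}`
(`IsNarrow.exists_partition`). Then `v = ∑ c i * a k 𝟙_{S i k}` behaves like a product of `u` with a
copy of `f` independent of it: `‖v‖ = ‖f‖ ‖u‖`, and with `m = ∫ f` also `‖v - γ m u‖ = ‖f - γ m‖
‖u‖` and `T v ≈ m T u`. The inequality is the triangle inequality for `v - γ m u = (I - T) v + (T v
- m T u) - m (γ u - T u)`, extended to all `f`, `u` by density. Taking `‖u‖ = 1`, using `|m| ≤ ‖f‖`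
and the supremum over `f` gives the bound by `‖I - γE‖`. For `γ = 1`, two-valued test functions give
`C_p ≤ ‖I - E‖`. -/

theorem sum_mul_indicator_of_mem {Ω ι : Type*} [Fintype ι] {A : ι → Set Ω}
    (hd : Pairwise (Function.onFun Disjoint A)) (c : ι → ℂ) {x : Ω} {i : ι} (hi : x ∈ A i) :
    ∑ j, c j * (A j).indicator (fun _ => (1 : ℂ)) x = c i := by
  have hj : ∀ j, j ≠ i → x ∉ A j := fun j hji hj => Set.disjoint_left.1 (hd hji) hj hi
  rw [Finset.sum_eq_single i (fun j _ hji => by simp [hj j hji]) (by simp)]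
  simp [hi]

/-! ### Step functions in `L^p` -/

section Step

variable {Ω : Type*} [MeasurableSpace Ω] {μ : Measure Ω} [IsFiniteMeasure μ] {p : ℝ≥0∞}

/-- The indicator function of a measurable set as an element of the complex `L^p`. -/
noncomputable abbrev indLp (μ : Measure Ω) [IsFiniteMeasure μ] (p : ℝ≥0∞) {A : Set Ω}
    (hA : MeasurableSet A) : Lp ℂ p μ :=
  indicatorConstLp p hA (measure_ne_top μ A) (1 : ℂ)

/-- The step function with value `c i` on `A i`. -/
noncomputable def stepLp (μ : Measure Ω) [IsFiniteMeasure μ] (p : ℝ≥0∞) {ι : Type*} [Fintype ι]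
    {A : ι → Set Ω} (hA : ∀ i, MeasurableSet (A i)) (c : ι → ℂ) : Lp ℂ p μ :=
  ∑ i, c i • indLp μ p (hA i)

theorem coeFn_stepLp {ι : Type*} [Fintype ι] {A : ι → Set Ω} (hA : ∀ i, MeasurableSet (A i))
    (c : ι → ℂ) :
    stepLp μ p hA c =ᵐ[μ] fun x => ∑ i, c i * (A i).indicator (fun _ => (1 : ℂ)) x := by
  have h1 : ∀ᵐ x ∂μ, ∀ i, (indLp μ p (hA i)) x = (A i).indicator (fun _ => (1 : ℂ)) x :=
    ae_all_iff.2 fun i => indicatorConstLp_coeFn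
  have h2 : ∀ᵐ x ∂μ, ∀ i, (c i • indLp μ p (hA i)) x = c i * (indLp μ p (hA i)) x :=
    ae_all_iff.2 fun i => (Lp.coeFn_smul (c i) _).trans (Filter.Eventually.of_forall fun x => rfl)
  have h3 : stepLp μ p hA c =ᵐ[μ] fun x => ∑ i, (c i • indLp μ p (hA i)) x := by
    classical
    have : ∀ s : Finset ι, (∑ i ∈ s, c i • indLp μ p (hA i) : Lp ℂ p μ)
        =ᵐ[μ] fun x => ∑ i ∈ s, (c i • indLp μ p (hA i)) x := by
      intro s
      induction s using Finset.induction_on with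
      | empty =>
        simp only [Finset.sum_empty]
        exact Lp.coeFn_zero ℂ p μ
      | insert a s ha ih =>
        rw [Finset.sum_insert ha]
        filter_upwards [Lp.coeFn_add (c a • indLp μ p (hA a))
          (∑ i ∈ s, c i • indLp μ p (hA i)), ih] with x hx hx'
        rw [Finset.sum_insert ha, hx, Pi.add_apply, hx']
    exact this Finset.univ
  filter_upwards [h1, h2, h3] with x h1 h2 h3
  rw [h3]
  exact Finset.sum_congr rfl fun i _ => by rw [h2, h1]

/-- The `L^p` norm of a step function on pairwise disjoint sets. -/
theorem norm_stepLp_rpow [Fact (1 ≤ p)] (hp : p ≠ ∞) {ι : Type*} [Fintype ι] {A : ι → Set Ω}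
    (hA : ∀ i, MeasurableSet (A i)) (hd : Pairwise (Function.onFun Disjoint A)) (c : ι → ℂ) :
    ‖stepLp μ p hA c‖ ^ p.toReal = ∑ i, ‖c i‖ ^ p.toReal * μ.real (A i) := by
  have hp1 : 1 ≤ p := Fact.out
  have hp0 : p ≠ 0 := (zero_lt_one.trans_le hp1).ne'
  have hr : 0 < p.toReal := ENNReal.toReal_pos hp0 hp
  have hI : 0 ≤ ∫ x, ‖stepLp μ p hA c x‖ ^ p.toReal ∂μ :=
    integral_nonneg fun x => by positivity
  rw [Lp.norm_def, (Lp.memLp _).eLpNorm_eq_integral_rpow_norm hp0 hp,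
    ENNReal.toReal_ofReal (Real.rpow_nonneg hI _), ← Real.rpow_mul hI, inv_mul_cancel₀ hr.ne',
    Real.rpow_one]
  have h : (fun x => ‖stepLp μ p hA c x‖ ^ p.toReal) =ᵐ[μ]
      fun x => ∑ i, (A i).indicator (fun _ => ‖c i‖ ^ p.toReal) x := by
    filter_upwards [coeFn_stepLp (p := p) (μ := μ) hA c] with x hx
    rw [hx]
    by_cases h : ∃ i, x ∈ A i
    · obtain ⟨i, hi⟩ := h
      have hj : ∀ j, j ≠ i → x ∉ A j := fun j hji hj =>
        Set.disjoint_left.1 (hd hji) hj hi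
      rw [sum_mul_indicator_of_mem hd c hi,
        Finset.sum_eq_single i (fun j _ hji => by simp [hj j hji]) (by simp)]
      simp [hi]
    · push Not at h
      simp [h, hr.ne']
  rw [integral_congr_ae h, integral_finsetSum _
    fun i _ => (integrable_const _).indicator (hA i)]
  exact Finset.sum_congr rfl fun i _ => by
    rw [integral_indicator_const _ (hA i), smul_eq_mul, mul_comm]

theorem stepLp_sub {ι : Type*} [Fintype ι] {A : ι → Set Ω} (hA : ∀ i, MeasurableSet (A i))
    (c d : ι → ℂ) : stepLp μ p hA c - stepLp μ p hA d = stepLp μ p hA fun i => c i - d i := by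
  simp [stepLp, sub_smul, Finset.sum_sub_distrib]

theorem sum_indLp_eq {κ : Type*} [Fintype κ] {A : Set Ω} (hA : MeasurableSet A) {S : κ → Set Ω}
    (hS : ∀ k, MeasurableSet (S k)) (hd : Pairwise (Function.onFun Disjoint S))
    (hU : ⋃ k, S k = A) : ∑ k, indLp μ p (hS k) = indLp μ p hA := by
  have h : stepLp μ p hS (fun _ => 1) = indLp μ p hA := by
    refine Lp.ext ?_
    filter_upwards [coeFn_stepLp (p := p) (μ := μ) hS fun _ => 1,
      indicatorConstLp_coeFn (p := p) (hs := hA) (hμs := measure_ne_top μ A) (c := (1 : ℂ))]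
      with x hx hx'
    rw [hx, hx']
    subst hU
    by_cases h : ∃ i, x ∈ S i
    · obtain ⟨i, hi⟩ := h
      rw [sum_mul_indicator_of_mem hd _ hi]
      simp [Set.mem_iUnion.2 ⟨i, hi⟩]
    · have : x ∉ ⋃ k, S k := by simpa using h
      push Not at h
      simp [h]
  simpa [stepLp] using h

end Step

/-! ### Splitting sets by a narrow operator -/

section Split

variable {Ω : Type*} [MeasurableSpace Ω] {μ : Measure Ω} [IsFiniteMeasure μ] {p : ℝ≥0∞}
  [Fact (1 ≤ p)] {Y : Type*} [NormedAddCommGroup Y] [NormedSpace ℂ Y]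

/-- A mean zero sign on `A` is a.e. `g = 2 𝟙_B - 𝟙_A` with `B = {g > 0}`, so the error is `T g / 2`,
and `∫ g = 0` says that `B` has half the measure. -/
theorem IsNarrow.exists_half {T : Lp ℂ p μ →L[ℂ] Y} (hT : IsNarrow T) {A : Set Ω}
    (hA : MeasurableSet A) {ε : ℝ} (hε : 0 < ε) :
    ∃ (B : Set Ω) (hB : MeasurableSet B), B ⊆ A ∧ μ.real B = μ.real A / 2 ∧
      ‖T (indLp μ p hB) - (1 / 2 : ℂ) • T (indLp μ p hA)‖ < ε := by
  -- Narrowness says nothing about null sets; there `B = A` works, since its indicator vanishes in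
  -- `L^p`.
  rcases eq_or_ne (μ A) 0 with h0 | h0
  · refine ⟨A, hA, subset_rfl, by simp [Measure.real, h0], ?_⟩
    have : indLp μ p hA = 0 := by
      refine Lp.ext ?_
      have h : ∀ᵐ x ∂μ, x ∉ A := measure_eq_zero_iff_ae_notMem.1 h0
      filter_upwards [indicatorConstLp_coeFn (p := p) (hs := hA) (hμs := measure_ne_top μ A)
        (c := (1 : ℂ)), Lp.coeFn_zero ℂ p μ, h] with x h1 h2 h3
      rw [h1, h2]
      simp [h3]
    simpa [this] using hε
  obtain ⟨g, hg, hgT⟩ := hT A hA.nullMeasurableSet (pos_iff_ne_zero.2 h0) ε hε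
  -- `g` is only a.e. measurable, so a measurable version is used to make `B` measurable.
  set g' := hg.aemeasurable.mk g
  have hgm : Measurable g' := hg.aemeasurable.measurable_mk
  have hgg : g =ᵐ[μ] g' := hg.aemeasurable.ae_eq_mk
  have hB : MeasurableSet (A ∩ {x | 0 < g' x}) :=
    hA.inter (measurableSet_lt measurable_const hgm)
  set B := A ∩ {x | 0 < g' x}
  have hval : ∀ᵐ x ∂μ, g x =
      2 * B.indicator (fun _ => (1 : ℝ)) x - A.indicator (fun _ => (1 : ℝ)) x := by
    filter_upwards [hgg] with x hx
    have h1 := hg.mem_values x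
    have h2 := hg.sq_eq x
    by_cases hxA : x ∈ A
    · simp only [Set.mem_insert_iff, Set.mem_singleton_iff] at h1
      rcases h1 with h1 | h1 | h1
      · have : x ∉ B := fun h => by
          have h3 : 0 < g' x := h.2
          rw [← hx] at h3; linarith
        simp [this, hxA, h1]
      · simp [hxA, h1] at h2
      · have : x ∈ B := ⟨hxA, by show 0 < g' x; rw [← hx, h1]; norm_num⟩
        simp only [this, hxA, h1, Set.indicator_of_mem]; norm_num
    · have : x ∉ B := fun h => hxA h.1
      simpa [hxA, this] using h2
  refine ⟨B, hB, Set.inter_subset_left, ?_, ?_⟩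
  · have h := hg.integral_eq_zero
    rw [integral_congr_ae hval, integral_sub
      (((integrable_const _).indicator hB).const_mul _) ((integrable_const _).indicator hA),
      integral_const_mul, integral_indicator_const _ hB, integral_indicator_const _ hA] at h
    simp only [smul_eq_mul, mul_one] at h
    linarith
  · have h : (hg.toIsSignOn.memLp p).toLp (fun ω => (g ω : ℂ)) =
        (2 : ℂ) • indLp μ p hB - indLp μ p hA := by
      refine Lp.ext ?_
      filter_upwards [MemLp.coeFn_toLp (hg.toIsSignOn.memLp p),
        Lp.coeFn_sub ((2 : ℂ) • indLp μ p hB) (indLp μ p hA),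
        Lp.coeFn_smul (2 : ℂ) (indLp μ p hB), hval,
        indicatorConstLp_coeFn (p := p) (hs := hA) (hμs := measure_ne_top μ A) (c := (1 : ℂ)),
        indicatorConstLp_coeFn (p := p) (hs := hB) (hμs := measure_ne_top μ B) (c := (1 : ℂ))]
        with x h1 h2 h3 h4 h5 h6
      rw [h1, h2, Pi.sub_apply, h3, Pi.smul_apply, h5, h6, h4]
      by_cases hxA : x ∈ A <;> by_cases hxB : x ∈ B <;> simp [hxA, hxB]
    rw [h, map_sub, map_smul] at hgT
    have h2 : T (indLp μ p hB) - (1 / 2 : ℂ) • T (indLp μ p hA) =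
        (1 / 2 : ℂ) • ((2 : ℂ) • T (indLp μ p hB) - T (indLp μ p hA)) := by
      rw [smul_sub, smul_smul]; norm_num
    rw [h2, norm_smul]
    have : ‖(1 / 2 : ℂ)‖ = 1 / 2 := by norm_num
    rw [this]
    linarith [norm_nonneg ((2 : ℂ) • T (indLp μ p hB) - T (indLp μ p hA))]

/-- A narrow operator almost does not distinguish the pieces of a suitable partition of `A` into
`2 ^ n` sets of equal measure. -/
theorem IsNarrow.exists_partition {T : Lp ℂ p μ →L[ℂ] Y} (hT : IsNarrow T) {A : Set Ω}
    (hA : MeasurableSet A) (n : ℕ) :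
    ∀ {κ : Type} [Fintype κ], Fintype.card κ = 2 ^ n → ∀ {ε : ℝ}, 0 < ε →
    ∃ (S : κ → Set Ω) (hS : ∀ k, MeasurableSet (S k)),
      Pairwise (Function.onFun Disjoint S) ∧ ⋃ k, S k = A ∧
      (∀ k, μ.real (S k) = μ.real A / 2 ^ n) ∧
      ∀ k, ‖T (indLp μ p (hS k)) - (1 / 2 ^ n : ℂ) • T (indLp μ p hA)‖ < ε := by
  induction n with
  | zero =>
    intro κ _ hκ ε hε
    obtain ⟨k₀, hk⟩ := Fintype.card_eq_one_iff.1 (by simpa using hκ)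
    have : Nonempty κ := ⟨k₀⟩
    exact ⟨fun _ => A, fun _ => hA, fun i j hij => absurd ((hk i).trans (hk j).symm) hij,
      Set.iUnion_const A, by simp, by simpa using hε⟩
  | succ n ih =>
    intro κ _ hκ ε hε
    have hc : Fintype.card (Fin (2 ^ n)) = 2 ^ n := by simp
    obtain ⟨S, hS, hd, hU, hm, hTS⟩ := ih hc (half_pos hε)
    choose B hB hBS hBm hBT using fun k => hT.exists_half (hS k) (half_pos hε)
    -- The freedom in `κ` allows indexing the halves by pairs; the `Bool` selects `B k` or its
    -- complement in `S k`.
    have e : κ ≃ Fin (2 ^ n) × Bool := Fintype.equivOfCardEq (by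
      simp [hκ, pow_succ])
    let S' : Fin (2 ^ n) × Bool → Set Ω := fun q => bif q.2 then B q.1 else S q.1 \ B q.1
    have hS' : ∀ q, MeasurableSet (S' q) := by
      rintro ⟨k, b⟩
      cases b
      · exact (hS k).diff (hB k)
      · exact hB k
    have hsub : ∀ q, S' q ⊆ S q.1 := by
      rintro ⟨k, b⟩
      cases b
      · exact Set.sdiff_subset
      · exact hBS k
    have hd' : Pairwise (Function.onFun Disjoint S') := by
      rintro ⟨k, b⟩ ⟨l, c⟩ hne
      by_cases hkl : k = l
      · subst hkl
        cases b <;> cases c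
        · exact absurd rfl hne
        · exact Set.disjoint_sdiff_left
        · exact Set.disjoint_sdiff_right
        · exact absurd rfl hne
      · exact (hd hkl).mono (hsub _) (hsub _)
    have hU' : ⋃ q, S' q = A := by
      rw [← hU, Set.iUnion_prod']
      refine Set.iUnion_congr fun k => ?_
      ext x
      simp only [Set.mem_iUnion, Bool.exists_bool, S', cond_true, cond_false, Set.mem_sdiff]
      have := @hBS k x
      tauto
    have hm' : ∀ q, μ.real (S' q) = μ.real A / 2 ^ (n + 1) := by
      rintro ⟨k, b⟩
      cases b
      · show μ.real (S k \ B k) = _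
        rw [measureReal_sdiff (hBS k) (hB k), hBm, hm, pow_succ]; ring
      · show μ.real (B k) = _
        rw [hBm, hm, pow_succ]; ring
    have hT' : ∀ q, ‖T (indLp μ p (hS' q)) - (1 / 2 ^ (n + 1) : ℂ) • T (indLp μ p hA)‖ < ε := by
      intro q
      obtain ⟨k, b⟩ := q
      -- The two halves of `S k` have opposite errors. The inherited error is itself halved, so the
      -- total is below `ε / 2 + ε / 4`.
      have hhalf : ‖T (indLp μ p (hS' (k, b))) - (1 / 2 : ℂ) • T (indLp μ p (hS k))‖ < ε / 2 := by
        cases b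
        · have h1 : indLp μ p (hS' (k, false)) = indLp μ p (hS k) - indLp μ p (hB k) := by
            have h2 := indicatorConstLp_disjoint_union (p := p) (hS' (k, false)) (hB k)
              (measure_ne_top μ _) (measure_ne_top μ _) Set.disjoint_sdiff_left (1 : ℂ)
            rw [eq_sub_iff_add_eq, indLp, indLp, ← h2]
            simp only [indLp, S', cond_false, Set.sdiff_union_of_subset (hBS k)]
          rw [h1, map_sub, ← norm_neg]
          refine lt_of_eq_of_lt (congrArg norm ?_) (hBT k)
          module
        · exact hBT k
      calc ‖T (indLp μ p (hS' (k, b))) - (1 / 2 ^ (n + 1) : ℂ) • T (indLp μ p hA)‖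
          = ‖(T (indLp μ p (hS' (k, b))) - (1 / 2 : ℂ) • T (indLp μ p (hS k))) + (1 / 2 : ℂ) •
              (T (indLp μ p (hS k)) - (1 / 2 ^ n : ℂ) • T (indLp μ p hA))‖ := by
            congr 1
            rw [smul_sub, smul_smul, pow_succ, show (1 / 2 * (1 / 2 ^ n) : ℂ) = 1 / (2 ^ n * 2) by
              field_simp]
            abel
        _ ≤ _ := norm_add_le _ _
        _ < ε / 2 + ε / 2 := by
            rw [norm_smul]
            have h3 : ‖(1 / 2 : ℂ)‖ = 1 / 2 := by norm_num
            rw [h3]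
            have := hTS k
            have := norm_nonneg (T (indLp μ p (hS k)) - (1 / 2 ^ n : ℂ) • T (indLp μ p hA))
            linarith
        _ = ε := by ring
    refine ⟨fun k => S' (e k), fun k => hS' (e k), fun i j hij => hd' (e.injective.ne hij),
      ?_, fun k => hm' _, fun k => hT' _⟩
    rw [← hU']
    exact e.surjective.iUnion_comp S'

end Split

end NarrowOp

namespace NarrowOp

/-! ### The inequality for step functions -/

section Step

variable {Ω : Type*} [MeasurableSpace Ω] {μ : Measure Ω} [IsProbabilityMeasure μ] {p : ℝ≥0∞}
  [Fact (1 ≤ p)]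

theorem norm_const_Lp (c : ℂ) : ‖(Lp.const p μ c : Lp ℂ p μ)‖ = ‖c‖ := by
  have hp1 : 1 ≤ p := Fact.out
  have h := Lp.norm_const p μ c (zero_lt_one.trans_le hp1).ne'
  simpa using h

theorem meanOp_stepLp {κ : Type*} [Fintype κ] {B : κ → Set Ω} (hB : ∀ k, MeasurableSet (B k))
    (hd : Pairwise (Function.onFun Disjoint B)) (hU : ⋃ k, B k = Set.univ) (a : κ → ℂ) :
    meanOp μ p (stepLp μ p hB a) = stepLp μ p hB fun _ => ∑ k, a k * μ.real (B k) := by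
  have h1 : ∫ ω, stepLp μ p hB a ω ∂μ = ∑ k, a k * μ.real (B k) := by
    rw [integral_congr_ae (coeFn_stepLp hB a), integral_finsetSum _ fun k _ =>
      ((integrable_const _).indicator (hB k)).const_mul _]
    refine Finset.sum_congr rfl fun k _ => ?_
    rw [integral_const_mul, integral_indicator_const _ (hB k)]
    simp
  rw [meanOp_apply, h1, stepLp, ← Finset.smul_sum, sum_indLp_eq MeasurableSet.univ hB hd hU,
    indLp, indicatorConstLp_univ]
  have := (Lp.constL p μ ℂ : ℂ →L[ℂ] Lp ℂ p μ).map_smul (∑ k, a k * μ.real (B k)) (1 : ℂ)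
  rw [smul_eq_mul, mul_one] at this
  exact this

/-- The main inequality, for step functions. -/
theorem IsNarrow.stepLp_le (hp : p ≠ ∞) {T : Lp ℂ p μ →L[ℂ] Lp ℂ p μ} (hT : IsNarrow T) (γ : ℂ)
    {ι : Type*} [Fintype ι] {A : ι → Set Ω} (hA : ∀ i, MeasurableSet (A i))
    (hAd : Pairwise (Function.onFun Disjoint A)) (c : ι → ℂ)
    {n : ℕ} {B : Fin (2 ^ n) → Set Ω} (hB : ∀ k, MeasurableSet (B k))
    (hBd : Pairwise (Function.onFun Disjoint B)) (hBU : ⋃ k, B k = Set.univ)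
    (hBm : ∀ k, μ.real (B k) = 1 / 2 ^ n) (a : Fin (2 ^ n) → ℂ) :
    ‖stepLp μ p hB a - γ • meanOp μ p (stepLp μ p hB a)‖ * ‖stepLp μ p hA c‖ ≤
      ‖ContinuousLinearMap.id ℂ (Lp ℂ p μ) - T‖ * (‖stepLp μ p hB a‖ * ‖stepLp μ p hA c‖) +
        ‖meanOp μ p (stepLp μ p hB a)‖ * ‖γ • stepLp μ p hA c - T (stepLp μ p hA c)‖ := by
  have hp1 : 1 ≤ p := Fact.out
  have hr : 0 < p.toReal := ENNReal.toReal_pos (zero_lt_one.trans_le hp1).ne' hp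
  set m : ℂ := ∑ k, a k * (1 / 2 ^ n : ℂ) with hm
  set u := stepLp μ p hA c with hu
  set f := stepLp μ p hB a with hf
  have hmean : meanOp μ p f = stepLp μ p hB fun _ => m := by
    rw [hf, meanOp_stepLp hB hBd hBU]
    simp only [hBm, hm]
    push_cast
    rfl
  have hnmean : ‖meanOp μ p f‖ = ‖m‖ := by
    rw [← Real.rpow_left_inj (norm_nonneg _) (norm_nonneg _) hr.ne', hmean,
      norm_stepLp_rpow hp hB hBd]
    simp only [hBm, Finset.sum_const, Finset.card_univ, Fintype.card_fin, nsmul_eq_mul]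
    push_cast
    field_simp
  have hdiff : f - γ • meanOp μ p f = stepLp μ p hB fun k => a k - γ * m := by
    rw [hmean, ← stepLp_sub, ← hf]
    simp only [stepLp, Finset.smul_sum, smul_smul]
  refine le_of_forall_pos_le_add fun ε hε => ?_
  set K : ℝ := ∑ i, ∑ k, ‖c i * a k‖ with hK
  have hK0 : 0 ≤ K := by positivity
  -- The `+ 1` covers `K = 0`.
  have hδ : 0 < ε / (K + 1) := by positivity
  choose S hS hSd hSU hSm hST using fun i =>
    hT.exists_partition (hA i) n (κ := Fin (2 ^ n)) (by simp) hδ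
  have hQ : ∀ q : ι × Fin (2 ^ n), MeasurableSet (S q.1 q.2) := fun q => hS _ _
  have hQd : Pairwise (Function.onFun Disjoint fun q : ι × Fin (2 ^ n) => S q.1 q.2) := by
    rintro ⟨i, k⟩ ⟨j, l⟩ hne
    by_cases hij : i = j
    · subst hij
      exact hSd i fun h : k = l => hne (by rw [h])
    · have hsub : ∀ i k, S i k ⊆ A i := fun i k => by
        rw [← hSU i]; exact Set.subset_iUnion (S i) k
      exact (hAd hij).mono (hsub _ _) (hsub _ _)
  -- Independence: `S i k` has measure `μ (A i) * μ (B k)`, so the norm factors for any values `b`;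
  -- it is used for `a` and for `a - γ m`.
  have hprod : ∀ b : Fin (2 ^ n) → ℂ, ‖stepLp μ p hQ fun q => c q.1 * b q.2‖ =
      ‖stepLp μ p hB b‖ * ‖u‖ := by
    intro b
    rw [← Real.rpow_left_inj (norm_nonneg _) (by positivity) hr.ne',
      Real.mul_rpow (norm_nonneg _) (norm_nonneg _), norm_stepLp_rpow hp hQ hQd,
      norm_stepLp_rpow hp hB hBd, norm_stepLp_rpow hp hA hAd, Fintype.sum_prod_type,
      Finset.sum_mul_sum, Finset.sum_comm]
    refine Finset.sum_congr rfl fun k _ => Finset.sum_congr rfl fun i _ => ?_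
    rw [norm_mul, Real.mul_rpow (norm_nonneg _) (norm_nonneg _), hSm, hBm]
    ring
  set v := stepLp μ p hQ fun q => c q.1 * a q.2 with hv
  have hconst : (stepLp μ p hQ fun q => c q.1 * (γ * m)) = (γ * m) • u := by
    rw [hu, stepLp, stepLp, Fintype.sum_prod_type, Finset.smul_sum]
    refine Finset.sum_congr rfl fun i _ => ?_
    rw [← sum_indLp_eq (hA i) (hS i) (hSd i) (hSU i), smul_smul, Finset.smul_sum]
    exact Finset.sum_congr rfl fun k _ => by rw [mul_comm]
  have hvm : v - (γ * m) • u = stepLp μ p hQ fun q => c q.1 * (a q.2 - γ * m) := by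
    rw [← hconst, hv, stepLp_sub]
    simp only [mul_sub]
  have hTv : ‖T v - m • T u‖ ≤ ε := by
    have h : T v - m • T u = ∑ i, ∑ k, (c i * a k) •
        (T (indLp μ p (hS i k)) - (1 / 2 ^ n : ℂ) • T (indLp μ p (hA i))) := by
      rw [hv, hu, stepLp, stepLp, map_sum, map_sum, Fintype.sum_prod_type, Finset.smul_sum,
        ← Finset.sum_sub_distrib]
      refine Finset.sum_congr rfl fun i _ => ?_
      simp only [smul_sub, Finset.sum_sub_distrib, map_smul, smul_smul]
      rw [← Finset.sum_smul, hm, Finset.sum_mul]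
      congr 2
      exact Finset.sum_congr rfl fun k _ => by ring
    rw [h]
    calc _ ≤ ∑ i, ∑ k, ‖c i * a k‖ * (ε / (K + 1)) := by
          refine (norm_sum_le _ _).trans (Finset.sum_le_sum fun i _ =>
            (norm_sum_le _ _).trans (Finset.sum_le_sum fun k _ => ?_))
          rw [norm_smul]
          exact mul_le_mul_of_nonneg_left (hST i k).le (norm_nonneg _)
      _ = K * (ε / (K + 1)) := by simp only [hK, Finset.sum_mul]
      _ ≤ (K + 1) * (ε / (K + 1)) := by gcongr; linarith
      _ = ε := by field_simp
  have hsplit : v - (γ * m) • u = (ContinuousLinearMap.id ℂ (Lp ℂ p μ) - T) v +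
      (T v - m • T u) - m • (γ • u - T u) := by
    simp only [sub_apply, ContinuousLinearMap.id_apply, smul_sub, smul_smul,
      mul_comm γ m]
    abel
  rw [hdiff, ← hprod, ← hprod, hnmean, ← hvm, hsplit, ← norm_smul m]
  have h1 := norm_sub_le ((ContinuousLinearMap.id ℂ (Lp ℂ p μ) - T) v + (T v - m • T u))
    (m • (γ • u - T u))
  have h2 := norm_add_le ((ContinuousLinearMap.id ℂ (Lp ℂ p μ) - T) v) (T v - m • T u)
  have h3 := (ContinuousLinearMap.id ℂ (Lp ℂ p μ) - T).le_opNorm v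
  linarith

end Step

/-! ### Dyadic intervals, density and the general inequality -/

section UnitInterval

/-- The interval number `k` of the division of `[0, 1]` into `N` equal intervals. -/
def equalPiece (N : ℕ) (k : Fin N) : Set unitInterval :=
  -- The `min` puts the endpoint `1` into the last piece.
  {x | min ⌊(N : ℝ) * x⌋₊ (N - 1) = k}

theorem measurableSet_equalPiece {N : ℕ} (k : Fin N) : MeasurableSet (equalPiece N k) := by
  have : Measurable fun x : unitInterval => min ⌊(N : ℝ) * x⌋₊ (N - 1) :=
    (Nat.measurable_floor.comp (measurable_const.mul measurable_subtype_coe)).min measurable_const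
  exact this (measurableSet_singleton _)

theorem pairwise_disjoint_equalPiece (N : ℕ) :
    Pairwise (Function.onFun Disjoint (equalPiece N)) := fun _ _ hkl =>
  Set.disjoint_left.2 fun _ (hx : _ = _) (hy : _ = _) => hkl (Fin.ext (hx.symm.trans hy))

theorem exists_mem_equalPiece {N : ℕ} (hN : 0 < N) (x : unitInterval) :
    ∃ k, x ∈ equalPiece N k :=
  ⟨⟨min ⌊(N : ℝ) * x⌋₊ (N - 1), (min_le_right _ _).trans_lt (Nat.sub_lt hN one_pos)⟩, rfl⟩

theorem abs_sub_le_of_mem_equalPiece {N : ℕ} {k : Fin N} {x : unitInterval}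
    (hx : x ∈ equalPiece N k) : |(x : ℝ) - k / N| ≤ 1 / N := by
  have hN : 0 < N := k.pos
  have hN' : (0 : ℝ) < N := by exact_mod_cast hN
  have hx' : min ⌊(N : ℝ) * x⌋₊ (N - 1) = k := hx
  have h0 : 0 ≤ (N : ℝ) * x := mul_nonneg hN'.le x.2.1
  have h1 : (N : ℝ) * x ≤ N := mul_le_of_le_one_right hN'.le x.2.2
  have h2 := Nat.floor_le h0
  have h3 := Nat.lt_floor_add_one ((N : ℝ) * x)
  have h4 : ((k : ℕ) : ℝ) ≤ N * x := le_trans (by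
    exact_mod_cast hx' ▸ min_le_left _ _) h2
  have h5 : (N : ℝ) * x ≤ k + 1 := by
    rcases min_choice ⌊(N : ℝ) * x⌋₊ (N - 1) with h | h
    · rw [h] at hx'
      rw [hx'] at h3
      exact h3.le
    · rw [h] at hx'
      have : ((k : ℕ) : ℝ) + 1 = N := by
        exact_mod_cast (by omega : (k : ℕ) + 1 = N)
      linarith
  have h6 : (x : ℝ) - k / N = (N * x - k) / N := by field_simp
  rw [h6, abs_div, abs_of_pos hN', abs_of_nonneg (by linarith)]
  gcongr
  linarith

theorem volume_equalPiece {N : ℕ} (k : Fin N) :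
    (volume : Measure unitInterval).real (equalPiece N k) = 1 / N := by
  have hN : 0 < N := k.pos
  have hN' : (0 : ℝ) < N := by exact_mod_cast hN
  have hk : ((k : ℕ) : ℝ) + 1 ≤ N := by exact_mod_cast k.2
  let l : unitInterval := ⟨k / N, by positivity, by rw [div_le_one hN']; linarith⟩
  let r : unitInterval := ⟨(k + 1) / N, by positivity, by rwa [div_le_one hN']⟩
  have h : equalPiece N k =ᵐ[volume] Set.Ico l r := by
    have h1 : ∀ᵐ x : unitInterval, x ≠ 1 := by simp [ae_iff]
    filter_upwards [h1] with x hx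
    have hx1 : (x : ℝ) < 1 := lt_of_le_of_ne x.2.2 fun h => hx (Subtype.ext h)
    have h0 : 0 ≤ (N : ℝ) * x := mul_nonneg hN'.le x.2.1
    have h2 : ⌊(N : ℝ) * x⌋₊ < N := (Nat.floor_lt h0).2 (by nlinarith)
    have h3 : min ⌊(N : ℝ) * x⌋₊ (N - 1) = ⌊(N : ℝ) * x⌋₊ := min_eq_left (by omega)
    refine propext ?_
    show min ⌊(N : ℝ) * x⌋₊ (N - 1) = k ↔ (k / N : ℝ) ≤ x ∧ (x : ℝ) < (k + 1) / N
    rw [h3, Nat.floor_eq_iff h0, div_le_iff₀ hN', lt_div_iff₀ hN', mul_comm]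
  rw [measureReal_congr h, Measure.real, unitInterval.volume_Ico]
  show (ENNReal.ofReal ((k + 1) / N - k / N)).toReal = _
  rw [← sub_div, add_sub_cancel_left, ENNReal.toReal_ofReal (by positivity)]

variable {p : ℝ≥0∞} [Fact (1 ≤ p)]

/-- The step functions on the dyadic intervals are dense. -/
theorem dense_dyadic_stepLp (hp : p ≠ ∞) :
    Dense {f : Lp ℂ p (volume : Measure unitInterval) | ∃ (n : ℕ) (a : Fin (2 ^ n) → ℂ),
      f = stepLp volume p (measurableSet_equalPiece (N := 2 ^ n)) a} := by
  refine ((ContinuousMap.toLp_denseRange ℂ (volume : Measure unitInterval) ℂ hp).mono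
    ?_).of_closure
  rintro _ ⟨f, rfl⟩
  refine Metric.mem_closure_iff.2 fun ε hε => ?_
  obtain ⟨δ, hδ, hfδ⟩ := Metric.uniformContinuous_iff.1
    (CompactSpace.uniformContinuous_of_continuous f.continuous) (ε / 2) (half_pos hε)
  obtain ⟨n, hn⟩ := exists_pow_lt_of_lt_one hδ (by norm_num : (1 / 2 : ℝ) < 1)
  have hN : (0 : ℝ) < 2 ^ n := by positivity
  have hmem : ∀ k : Fin (2 ^ n), ((k : ℕ) : ℝ) / 2 ^ n ∈ unitInterval := fun k =>
    ⟨by positivity, by rw [div_le_one hN]; exact_mod_cast k.2.le⟩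
  -- Sample the continuous function at left endpoints; uniform closeness bounds the `L^p` distance
  -- because the total measure is `1`.
  refine ⟨_, ⟨n, fun k => f ⟨_, hmem k⟩, rfl⟩, ?_⟩
  rw [dist_eq_norm]
  set g := stepLp volume p (measurableSet_equalPiece (N := 2 ^ n)) fun k => f ⟨_, hmem k⟩ with hg
  refine (Lp.norm_le_of_ae_bound (half_pos hε).le ?_).trans_lt ?_
  · filter_upwards [Lp.coeFn_sub (ContinuousMap.toLp p volume ℂ f) g,
      ContinuousMap.coeFn_toLp (p := p) volume (𝕜 := ℂ) f,
      coeFn_stepLp (μ := volume) (p := p) (measurableSet_equalPiece (N := 2 ^ n))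
        fun k => f ⟨_, hmem k⟩] with x h1 h2 h3
    obtain ⟨k, hk⟩ := exists_mem_equalPiece (pow_pos two_pos n) x
    rw [h1, Pi.sub_apply, h2, hg, h3,
      sum_mul_indicator_of_mem (pairwise_disjoint_equalPiece _) _ hk, ← dist_eq_norm]
    refine (hfδ ?_).le
    have h4 := abs_sub_le_of_mem_equalPiece hk
    push_cast at h4
    rw [Subtype.dist_eq, Real.dist_eq]
    refine h4.trans_lt ?_
    simpa using hn
  · simp [measureUnivNNReal, hε]

/-- The main inequality. -/
theorem IsNarrow.norm_sub_meanOp_mul_le (hp : p ≠ ∞)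
    {T : Lp ℂ p (volume : Measure unitInterval) →L[ℂ] Lp ℂ p (volume : Measure unitInterval)}
    (hT : IsNarrow T) (γ : ℂ) (f u : Lp ℂ p (volume : Measure unitInterval)) :
    ‖f - γ • meanOp volume p f‖ * ‖u‖ ≤
      ‖ContinuousLinearMap.id ℂ (Lp ℂ p (volume : Measure unitInterval)) - T‖ * (‖f‖ * ‖u‖) +
        ‖meanOp volume p f‖ * ‖γ • u - T u‖ := by
  have hd := dense_dyadic_stepLp (p := p) hp
  refine isClosed_property2 (e := Subtype.val) hd.denseRange_val (p := fun f u =>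
    ‖f - γ • meanOp volume p f‖ * ‖u‖ ≤
      ‖ContinuousLinearMap.id ℂ (Lp ℂ p (volume : Measure unitInterval)) - T‖ * (‖f‖ * ‖u‖) +
        ‖meanOp volume p f‖ * ‖γ • u - T u‖) ?_ ?_ f u
  · exact isClosed_le (by fun_prop) (by fun_prop)
  · rintro ⟨_, n, a, rfl⟩ ⟨_, m, c, rfl⟩
    refine hT.stepLp_le hp γ _ (pairwise_disjoint_equalPiece _) c _
      (pairwise_disjoint_equalPiece _) (Set.iUnion_eq_univ_iff.2
        (exists_mem_equalPiece (pow_pos two_pos n))) (fun k => ?_) a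
    rw [volume_equalPiece]
    push_cast
    rfl

/-- The constant function `1` shows that `L^p` has unit vectors. -/
theorem nonempty_sphere_Lp :
    Nonempty (Metric.sphere (0 : Lp ℂ p (volume : Measure unitInterval)) 1) :=
  ⟨⟨Lp.const p volume (1 : ℂ), by rw [mem_sphere_zero_iff_norm, norm_const_Lp, norm_one]⟩⟩

theorem IsNarrow.norm_id_sub_smul_meanOp_le (hp : p ≠ ∞)
    {T : Lp ℂ p (volume : Measure unitInterval) →L[ℂ] Lp ℂ p (volume : Measure unitInterval)}
    (hT : IsNarrow T) (γ : ℂ) :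
    ‖ContinuousLinearMap.id ℂ (Lp ℂ p (volume : Measure unitInterval)) - γ • meanOp volume p‖ ≤
      ‖ContinuousLinearMap.id ℂ (Lp ℂ p (volume : Measure unitInterval)) - T‖ +
        ⨅ u : Metric.sphere (0 : Lp ℂ p (volume : Measure unitInterval)) 1,
          ‖γ • (u : Lp ℂ p (volume : Measure unitInterval)) - T u‖ := by
  have := nonempty_sphere_Lp (p := p)
  rw [← sub_le_iff_le_add']
  refine le_ciInf fun ⟨u, hu⟩ => ?_
  rw [sub_le_iff_le_add']
  refine ContinuousLinearMap.opNorm_le_bound _ (by positivity) fun f => ?_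
  have h := hT.norm_sub_meanOp_mul_le hp γ f u
  rw [mem_sphere_zero_iff_norm.1 hu, mul_one, mul_one] at h
  have h2 : ‖meanOp (volume : Measure unitInterval) p f‖ ≤ ‖f‖ := by
    rw [meanOp_apply, norm_const_Lp]
    exact norm_integral_le (volume : Measure unitInterval) p f
  calc _ ≤ _ := h
    _ ≤ _ := by
      rw [add_mul, mul_comm ‖γ • u - T u‖]
      gcongr

end UnitInterval

end NarrowOp

namespace NarrowOp

/-! ### The lower bound for `‖I - E‖` -/

section Constant

variable {p : ℝ≥0∞} [Fact (1 ≤ p)]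

/-- The bound for `‖I - E‖` given by a function with value `a` on `[0, s]` and `b` on `(s, 1]`. -/
theorem le_norm_id_sub_meanOp_rpow_mul (hp : p ≠ ∞) {s : ℝ} (hs : s ∈ unitInterval) (a b : ℝ) :
    s * |(1 - s) * (a - b)| ^ p.toReal + (1 - s) * |s * (a - b)| ^ p.toReal ≤
      ‖ContinuousLinearMap.id ℂ (Lp ℂ p (volume : Measure unitInterval)) - meanOp volume p‖ ^
        p.toReal * (s * |a| ^ p.toReal + (1 - s) * |b| ^ p.toReal) := by
  let B : Bool → Set unitInterval := fun i => bif i then Set.Iic ⟨s, hs⟩ else (Set.Iic ⟨s, hs⟩)ᶜ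
  have hB : ∀ i, MeasurableSet (B i) := by
    intro i
    cases i
    · exact measurableSet_Iic.compl
    · exact measurableSet_Iic
  have hd : Pairwise (Function.onFun Disjoint B) := by
    intro i j hij
    cases i <;> cases j
    · exact absurd rfl hij
    · exact disjoint_compl_left
    · exact disjoint_compl_right
    · exact absurd rfl hij
  have hU : ⋃ i, B i = Set.univ := by
    ext x
    simp only [Set.mem_iUnion, Bool.exists_bool, Set.mem_univ, iff_true]
    exact (em (x ∈ Set.Iic (⟨s, hs⟩ : unitInterval))).symm
  have ht : (volume : Measure unitInterval).real (B true) = s := by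
    show (volume : Measure unitInterval).real (Set.Iic ⟨s, hs⟩) = s
    rw [Measure.real, unitInterval.volume_Iic, ENNReal.toReal_ofReal hs.1]
  have hf : (volume : Measure unitInterval).real (B false) = 1 - s := by
    rw [← ht]
    exact probReal_compl_eq_one_sub measurableSet_Iic
  let c : Bool → ℂ := fun i => bif i then (a : ℂ) else b
  have h := (ContinuousLinearMap.id ℂ (Lp ℂ p (volume : Measure unitInterval)) -
    meanOp volume p).le_opNorm (stepLp volume p hB c)
  rw [sub_apply, ContinuousLinearMap.id_apply, meanOp_stepLp hB hd hU, stepLp_sub] at h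
  have h2 := Real.rpow_le_rpow (norm_nonneg _) h ENNReal.toReal_nonneg (z := p.toReal)
  rw [Real.mul_rpow (norm_nonneg _) (norm_nonneg _), norm_stepLp_rpow hp hB hd,
    norm_stepLp_rpow hp hB hd] at h2
  simp only [Fintype.sum_bool, ht, hf, c, cond_true, cond_false] at h2
  have h3 : (a : ℂ) - (a * s + b * (1 - s : ℝ)) = (((1 - s) * (a - b) : ℝ) : ℂ) := by
    push_cast; ring
  have h4 : (b : ℂ) - (a * s + b * (1 - s : ℝ)) = ((-(s * (a - b)) : ℝ) : ℂ) := by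
    push_cast; ring
  rw [h3, h4] at h2
  simp only [Complex.norm_real, Real.norm_eq_abs, abs_neg] at h2
  linarith

/-- With `a - b = 1`, only the norm of the two-valued function depends on the values. Stationarity,
`s a ^ (r - 1) = (1 - s) |b| ^ (r - 1)` for `b < 0 < a`, gives `a` and `|b|` proportional to `(1 -
s) ^ q` and `s ^ q`. -/
theorem cpFun_le_norm_id_sub_meanOp_of_mem_Ioo (hp : p ≠ ∞) (hp1 : 1 < p.toReal) {s : ℝ}
    (hs : s ∈ Set.Ioo (0 : ℝ) 1) : cpFun p.toReal s ≤
      ‖ContinuousLinearMap.id ℂ (Lp ℂ p (volume : Measure unitInterval)) - meanOp volume p‖ := by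
  set M := ‖ContinuousLinearMap.id ℂ (Lp ℂ p (volume : Measure unitInterval)) - meanOp volume p‖
    with hM
  set r := p.toReal with hr
  have hr0 : 0 < r := by linarith
  have hr1 : 0 < r - 1 := by linarith
  obtain ⟨hs0, hs1⟩ := hs
  have hs1' : 0 < 1 - s := by linarith
  set q := 1 / (r - 1) with hq
  -- This collapses `s a ^ r + (1 - s) |b| ^ r` to `s (1 - s) / D ^ (r - 1)`.
  have hqr : q * r = 1 + q := by rw [hq]; field_simp; ring
  set D := s ^ q + (1 - s) ^ q with hD
  have hD0 : 0 < D := by positivity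
  set P := s ^ (r - 1) + (1 - s) ^ (r - 1) with hP
  have hP0 : 0 < P := by positivity
  have h := le_norm_id_sub_meanOp_rpow_mul hp ⟨hs0.le, hs1.le⟩ ((1 - s) ^ q / D) (-(s ^ q / D))
  rw [← hM, ← hr] at h
  have hab : (1 - s) ^ q / D - -(s ^ q / D) = 1 := by
    rw [sub_neg_eq_add, ← add_div, add_comm, div_self hD0.ne']
  have hpow : ∀ {t : ℝ}, 0 < t → t ^ r = t * t ^ (r - 1) := fun {t} ht => by
    rw [Real.rpow_sub_one ht.ne']; field_simp
  have hpow' : ∀ {t : ℝ}, 0 < t → (t ^ q / D) ^ r = t * t ^ q / D ^ r := fun {t} ht => by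
    rw [Real.div_rpow (by positivity) hD0.le, ← Real.rpow_mul ht.le, hqr, Real.rpow_add ht,
      Real.rpow_one]
  rw [hab, mul_one, mul_one, abs_neg, abs_of_pos hs0, abs_of_pos hs1',
    abs_of_pos (by positivity), abs_of_pos (by positivity), hpow' hs0, hpow' hs1', hpow hs0,
    hpow hs1', hpow hD0] at h
  have h1 : P * D ^ (r - 1) ≤ M ^ r := by
    have h2 : s * (1 - s) * P ≤ s * (1 - s) * (M ^ r / D ^ (r - 1)) := by
      refine le_of_eq_of_le ?_ (h.trans_eq ?_)
      · rw [hP]; ring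
      · field_simp
        rw [hD]; ring
    have h3 := le_of_mul_le_mul_left h2 (by positivity)
    rwa [le_div_iff₀ (by positivity)] at h3
  have h2 : cpFun r s ^ r = P * D ^ (r - 1) := by
    rw [cpFun, ← hq, ← hD, ← hP, Real.mul_rpow (by positivity) (by positivity),
      ← Real.rpow_mul hP0.le, ← Real.rpow_mul hD0.le, one_div_mul_cancel hr0.ne', Real.rpow_one,
      sub_mul, one_div_mul_cancel hr0.ne', one_mul]
  rw [← Real.rpow_le_rpow_iff _ (norm_nonneg _) hr0, h2]
  · exact h1
  · rw [cpFun, ← hq, ← hD, ← hP]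
    positivity

/-- A nonzero mean zero function is fixed by `I - E`. This covers the endpoints `α = 0, 1`, where
`cpFun` equals `1`. -/
theorem one_le_norm_id_sub_meanOp (hp : p ≠ ∞) :
    1 ≤ ‖ContinuousLinearMap.id ℂ (Lp ℂ p (volume : Measure unitInterval)) - meanOp volume p‖ := by
  have hp1 : 1 ≤ p := Fact.out
  have hr : 0 < p.toReal := ENNReal.toReal_pos (zero_lt_one.trans_le hp1).ne' hp
  have h := le_norm_id_sub_meanOp_rpow_mul hp (s := 1 / 2) ⟨by norm_num, by norm_num⟩ 1 (-1)
  norm_num at h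
  rwa [← Real.rpow_le_rpow_iff zero_le_one (norm_nonneg _) hr, Real.one_rpow]

theorem Cp_le_norm_id_sub_meanOp (hp : p ≠ ∞) : Cp p.toReal ≤
    ‖ContinuousLinearMap.id ℂ (Lp ℂ p (volume : Measure unitInterval)) - meanOp volume p‖ := by
  have hp1 : 1 ≤ p := Fact.out
  have hr1 : 1 ≤ p.toReal := by simpa using ENNReal.toReal_mono hp hp1
  rcases hr1.eq_or_lt with h1 | h1
  · rw [Cp, if_pos h1.symm]
    refine le_of_forall_pos_lt_add fun ε hε => ?_
    -- For `p = 1`, the indicator of `[0, s]` gives the bound `2 (1 - s) ≥ 2 - ε / 2`.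
    set s := min (ε / 4) (1 / 2) with hs
    have hs0 : 0 < s := by positivity
    have hs1 : s ≤ 1 / 2 := min_le_right _ _
    have hs2 : s ≤ ε / 4 := min_le_left _ _
    have h := le_norm_id_sub_meanOp_rpow_mul hp (s := s) ⟨hs0.le, by linarith⟩ 1 0
    simp only [← h1, Real.rpow_one, sub_zero, mul_one, abs_one, abs_zero, mul_zero, add_zero,
      abs_of_pos hs0, abs_of_pos (by linarith : 0 < 1 - s)] at h
    have h3 : s * (2 * (1 - s)) ≤ s * ‖ContinuousLinearMap.id ℂ
        (Lp ℂ p (volume : Measure unitInterval)) - meanOp volume p‖ := by linarith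
    have := le_of_mul_le_mul_left h3 hs0
    linarith
  · obtain ⟨⟨s, hs, hcs⟩, -⟩ := isGreatest_Cp h1
    rw [← hcs]
    have hr : p.toReal - 1 ≠ 0 := by linarith
    rcases hs.1.eq_or_lt with h0 | h0
    · refine le_of_eq_of_le ?_ (one_le_norm_id_sub_meanOp hp)
      simp [cpFun, ← h0, Real.zero_rpow hr, Real.zero_rpow (inv_ne_zero hr)]
    rcases hs.2.eq_or_lt with h2 | h2
    · refine le_of_eq_of_le ?_ (one_le_norm_id_sub_meanOp hp)
      simp [cpFun, h2, Real.zero_rpow hr, Real.zero_rpow (inv_ne_zero hr)]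
    exact cpFun_le_norm_id_sub_meanOp_of_mem_Ioo hp h1 ⟨h0, h2⟩

end Constant

end NarrowOp

theorem theorem3 (p : ℝ≥0∞) [Fact (1 ≤ p)] (hp : p ≠ ∞)
    (T : Lp ℂ p (volume : Measure unitInterval) →L[ℂ] Lp ℂ p (volume : Measure unitInterval))
    (hT : NarrowOp.IsNarrow T) :
    (∀ γ : ℂ,
      ‖ContinuousLinearMap.id ℂ (Lp ℂ p (volume : Measure unitInterval)) -
          γ • NarrowOp.meanOp (volume : Measure unitInterval) p‖ ≤
        ‖ContinuousLinearMap.id ℂ (Lp ℂ p (volume : Measure unitInterval)) - T‖ +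
          ⨅ u : Metric.sphere (0 : Lp ℂ p (volume : Measure unitInterval)) 1,
            ‖γ • (u : Lp ℂ p (volume : Measure unitInterval)) - T u‖) ∧
    NarrowOp.Cp p.toReal ≤
      ‖ContinuousLinearMap.id ℂ (Lp ℂ p (volume : Measure unitInterval)) - T‖ +
        ⨅ u : Metric.sphere (0 : Lp ℂ p (volume : Measure unitInterval)) 1,
          ‖(u : Lp ℂ p (volume : Measure unitInterval)) - T u‖ := by
  have h := fun γ : ℂ => hT.norm_id_sub_smul_meanOp_le hp γ
  refine ⟨h, (NarrowOp.Cp_le_norm_id_sub_meanOp hp).trans ?_⟩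
  simpa only [one_smul] using h 1
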